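/- Let $V$ be a finite set of vertices, partitioned as $V = V_1 \sqcup V_2$ (either part may be empty), and let $E \subseteq V \times V$ be such that every vertex has at least one successor. A play from $v \in V$ is an infinite sequence $\pi = \pi_0\pi_1\cdots \in V^\omega$ with $\pi_0 = v$ and $(\pi_k,\pi_{k+1}) \in E$ for all $k$; $\mathsf{Plays}(v)$ is the set of plays from $v$. For $i \in \{1,2\}$, a strategy of player $i$ is a map $\sigma_i : V^*V_i \to V$ sending every $hu$, with $h \in V^*$ and $u \in V_i$, to a successor of $u$; $\Gamma_i$ is the set of these strategies, and $\mathsf{Plays}_{\sigma_i}(v)$ is the set of all $\pi \in \mathsf{Plays}(v)$ with $\pi_{k+1} = \sigma_i(\pi_0\cdots\pi_k)$ whenever $\pi_k \in V_i$. Let $\ltimes \subseteq V^\omega \times V^\omega$ be an $\omega$-automatic relation, i.e. there is a deterministic parity automaton with finitely many states over the alphabet $V \times V$ that accepts a word $(x_0,y_0)(x_1,y_1)\cdots$ (the maximum priority seen infinitely often along its run is even) if and only if $x \ltimes y$. For $v \in V$ put $$\mathsf{Val}_1(v) = \{\pi \in \mathsf{Plays}(v) \mid \exists \sigma_1 \in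 \Gamma_1\ \forall \rho \in \mathsf{Plays}_{\sigma_1}(v) : \pi \ltimes \rho\},$$ $$\mathsf{Val}_2(v) = \{\pi \in \mathsf{Plays}(v) \mid \exists \sigma_2 \in \Gamma_2\ \forall \rho \in \mathsf{Plays}_{\sigma_2}(v) : \pi \not\ltimes \rho\}.$$ Then, for every $v \in V$, $$\mathsf{Val}_1(v) = \mathsf{Plays}(v) \setminus \mathsf{Val}_2(v).$$ -/

import Mathlib

namespace AutomaticGames

/-- A deterministic parity automaton on infinite words, with states `Q`, alphabet `S` and
priorities on the states. -/
structure DPW (Q S : Type*) where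
  start : Q
  step : Q → S → Q
  priority : Q → ℕ

/-- The run of the automaton on the infinite word `w`: `M.run w n` is the state reached after
reading the first `n` letters. -/
def DPW.run {Q S : Type*} (M : DPW Q S) (w : ℕ → S) : ℕ → Q
  | 0 => M.start
  | n + 1 => M.step (M.run w n) (w n)

/-- Acceptance: the maximum priority seen infinitely often along the run is even. -/
def DPW.Accepts {Q S : Type*} (M : DPW Q S) (w : ℕ → S) : Prop :=
  ∃ p, IsGreatest {c | ∃ᶠ n in Filter.atTop, M.priority (M.run w n) = c} p ∧ Even p

/-- A binary relation on infinite words over `S` is ω-automatic if a DPW with finitely many states,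
reading the two words synchronously, accepts exactly the related pairs. -/
def IsOmegaAutomatic {S : Type*} (R : (ℕ → S) → (ℕ → S) → Prop) : Prop :=
  ∃ (Q : Type) (_ : Finite Q) (M : DPW Q (S × S)),
    ∀ x y : ℕ → S, R x y ↔ M.Accepts (fun n => (x n, y n))

/-- An arena with vertices `V` and players `P`. The partition of the vertices among the
players is given by `owner`; every vertex has a successor. -/
structure Arena (V P : Type*) where
  edge : V → V → Prop
  owner : V → P
  exists_succ : ∀ v, ∃ w, edge v w

/-- The plays that start at `v`. -/
def Arena.plays {V P : Type*} (A : Arena V P) (v : V) : Set (ℕ → V) :=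
  {π | π 0 = v ∧ ∀ k, A.edge (π k) (π (k + 1))}

/-- A strategy of player `i`, a map from `V^* V_i` to `V`: `next h v` is the successor of `v`
chosen after the history `hv`. -/
structure Arena.Strategy {V P : Type*} (A : Arena V P) (i : P) where
  next : List V → {v : V // A.owner v = i} → V
  next_edge : ∀ (h : List V) (v : {v : V // A.owner v = i}), A.edge v.1 (next h v)

/-- The plays that start at `v` and are consistent with the strategy `σ`. -/
def Arena.Strategy.plays {V P : Type*} {A : Arena V P} {i : P} (σ : A.Strategy i) (v : V) :
    Set (ℕ → V) :=
  {π | π ∈ A.plays v ∧ ∀ (k : ℕ) (hk : A.owner (π k) = i),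
    π (k + 1) = σ.next (List.ofFn fun j : Fin k => π j) ⟨π k, hk⟩}

/-- The value of `v` for player `i` whose preference relation is `R`: the plays `π` from `v`
such that player `i` has a strategy all of whose consistent plays `ρ` from `v` satisfy
`R π ρ`. -/
def Arena.value {V P : Type*} (A : Arena V P) (i : P) (R : (ℕ → V) → (ℕ → V) → Prop) (v : V) :
    Set (ℕ → V) :=
  {π | π ∈ A.plays v ∧ ∃ σ : A.Strategy i, ∀ ρ ∈ σ.plays v, R π ρ}

/-- The two players. -/
inductive Player
  | one
  | two

/-- A two-player zero-sum game with an ω-automatic preference relation `pref` for player 1;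
the preference relation of player 2 is the complement of `pref`. -/
structure ZeroSumGame (V : Type*) where
  arena : Arena V Player
  pref : (ℕ → V) → (ℕ → V) → Prop
  pref_automatic : IsOmegaAutomatic pref

/-- The value of `v` for player 1. -/
def ZeroSumGame.val₁ {V : Type*} (G : ZeroSumGame V) (v : V) : Set (ℕ → V) :=
  G.arena.value Player.one G.pref v

/-- The value of `v` for player 2. -/
def ZeroSumGame.val₂ {V : Type*} (G : ZeroSumGame V) (v : V) : Set (ℕ → V) :=
  G.arena.value Player.two (fun x y => ¬ G.pref x y) v

end AutomaticGames

/-! Fix the reference play `π`. Whether `π` is related to `ρ` is a parity condition on the run over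
`(π, ρ)`, so choosing `ρ` amounts to a parity game on `ℕ × Q × V`. The clock in `ℕ` is needed
because `π` is arbitrary; it makes the graph infinite, but only finitely many priorities occur.
Positional determinacy (`exists_steers`) gives a winner from the initial position, and her strategy
lifts to the arena because a history determines its position (`exists_strategy_of_steers`). Both
players cannot succeed, since two opposing strategies share a play (`Arena.exists_common_play`).
Determinacy is Zielonka's induction on the priority bound. Zorn's lemma replaces transfinite
attractors: a maximal strategy absorbs every vertex from which its domain or target can be forced in
one move (`Steers.escape`). -/

namespace AutomaticGames

/-! ### Positional determinacy of parity games -/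

section ParityGames

variable {X : Type*}

/-- The vertices with an outgoing edge. -/
def dom (S : X → X → Prop) : Set X := {x | ∃ y, S x y}

/-- The edge relation `S` is a nondeterministic positional strategy of player `p` in the game graph
`E`, defined on `dom S`: a play that follows it either reaches the target `T` or satisfies `Φ`. -/
structure Steers (owner : X → Player) (E : X → X → Prop) (p : Player) (T : Set X)
    (Φ : (ℕ → X) → Prop) (S : X → X → Prop) : Prop where
  edge : ∀ {x y}, S x y → E x y
  notMem : ∀ {x y}, S x y → x ∉ T
  closed : ∀ {x y}, S x y → y ∈ dom S ∨ y ∈ T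
  opp : ∀ {x y z}, owner x ≠ p → S x y → E x z → S x z
  win : ∀ π : ℕ → X, (∀ k, S (π k) (π (k + 1))) → Φ π

/-- `S'` extends `S` without adding edges at the vertices where `S` is already defined. -/
def Extends (S S' : X → X → Prop) : Prop :=
  (∀ x y, S x y → S' x y) ∧ ∀ x y, x ∈ dom S → S' x y → S x y

theorem Extends.trans {S₁ S₂ S₃ : X → X → Prop} (h : Extends S₁ S₂) (h' : Extends S₂ S₃) :
    Extends S₁ S₃ := by
  refine ⟨fun x y hxy => h'.1 _ _ (h.1 _ _ hxy), fun x y hx hxy => h.2 _ _ hx (h'.2 _ _ ?_ hxy)⟩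
  obtain ⟨z, hz⟩ := hx
  exact ⟨z, h.1 _ _ hz⟩

variable {owner : X → Player} {E : X → X → Prop} {p : Player} {T : Set X} {Φ : (ℕ → X) → Prop}

/-- A path that enters the domain of a strategy `S` and from then on takes only edges of `S` at the
vertices of `dom S` follows `S` forever. -/
theorem Steers.follow {S : X → X → Prop} (hS : Steers owner E p T Φ S) {π : ℕ → X} {m : ℕ}
    (hT : ∀ k, π (k + m) ∉ T) (h₀ : π m ∈ dom S)
    (h : ∀ k, π (k + m) ∈ dom S → S (π (k + m)) (π (k + 1 + m))) (k : ℕ) :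
    S (π (k + m)) (π (k + 1 + m)) := by
  apply h
  induction k with
  | zero => simpa using h₀
  | succ k ih => exact (hS.closed (h k ih)).resolve_right (hT _)

theorem of_tail {Φ : (ℕ → X) → Prop} (hΦ : ∀ π : ℕ → X, Φ (fun n => π (n + 1)) → Φ π) (m : ℕ)
    (π : ℕ → X) (h : Φ (fun n => π (n + m))) : Φ π := by
  induction m with
  | zero => exact h
  | succ m ih =>
    apply ih
    apply hΦ
    convert h using 3
    omega

/-- There is a maximal strategy that reaches `T` or ensures `Φ`. -/
theorem exists_maximal_steers (owner : X → Player) (E : X → X → Prop) (p : Player) (T : Set X)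
    (Φ : (ℕ → X) → Prop) :
    ∃ S, Steers owner E p T Φ S ∧
      ∀ S', Steers owner E p T Φ S' → Extends S S' → dom S' ⊆ dom S := by
  obtain ⟨⟨S, hS⟩, hmax⟩ := exists_maximal_of_chains_bounded
    (α := {S // Steers owner E p T Φ S}) (r := fun S S' => Extends S.1 S'.1) (by
      intro c hc
      have key : ∀ S ∈ c, ∀ S' ∈ c, ∀ x y, x ∈ dom S.1 → S'.1 x y → S.1 x y := by
        intro S hS S' hS' x y hx hxy
        by_cases heq : S = S'
        · exact heq ▸ hxy
        · rcases hc hS hS' heq with h | h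
          · exact h.2 _ _ hx hxy
          · exact h.1 _ _ hxy
      refine ⟨⟨fun x y => ∃ S ∈ c, S.1 x y, ?_, ?_, ?_, ?_, ?_⟩, ?_⟩
      · rintro x y ⟨S, -, h⟩
        exact S.2.edge h
      · rintro x y ⟨S, -, h⟩
        exact S.2.notMem h
      · rintro x y ⟨S, hS, h⟩
        rcases S.2.closed h with ⟨z, hz⟩ | h
        · exact Or.inl ⟨z, S, hS, hz⟩
        · exact Or.inr h
      · rintro x y z hx ⟨S, hS, h⟩ hz
        exact ⟨S, hS, S.2.opp hx h hz⟩
      · intro π hπ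
        -- The member of the chain giving the first move governs the whole play, as no other member
        -- adds edges on its domain.
        obtain ⟨S, hS, h₀⟩ := hπ 0
        refine S.2.win π fun k => S.2.follow (m := 0) ?_ ⟨_, h₀⟩ ?_ k
        · intro k
          obtain ⟨S', -, h⟩ := hπ k
          exact S'.2.notMem h
        · intro k hk
          obtain ⟨S', hS', h⟩ := hπ k
          exact key S hS S' hS' _ _ hk h
      · intro S hS
        refine ⟨fun x y h => ⟨S, hS, h⟩, ?_⟩
        rintro x y hx ⟨S', hS', h⟩
        exact key S hS S' hS' _ _ hx h) (fun h h' => h.trans h')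
  refine ⟨S, hS, fun S' hS' hext x => ?_⟩
  rintro ⟨y, hy⟩
  exact ⟨y, (hmax ⟨S', hS'⟩ hext).1 _ _ hy⟩

/-- A vertex outside a maximal strategy with an edge into it belongs to the opponent, who can
avoid the strategy from there. -/
theorem Steers.escape {S : X → X → Prop} (hΦ : ∀ π : ℕ → X, Φ (fun n => π (n + 1)) → Φ π)
    (hS : Steers owner E p T Φ S)
    (hmax : ∀ S', Steers owner E p T Φ S' → Extends S S' → dom S' ⊆ dom S)
    {x y : X} (hx : x ∉ dom S) (hxT : x ∉ T) (hxy : E x y) (hy : y ∈ dom S ∨ y ∈ T) :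
    owner x ≠ p ∧ ∃ z, E x z ∧ z ∉ dom S ∧ z ∉ T := by
  by_contra hcon
  have hall : owner x ≠ p → ∀ z, E x z → z ∈ dom S ∨ z ∈ T := by
    intro h z hz
    by_contra hz'
    exact hcon ⟨h, z, hz, not_or.1 hz'⟩
  -- One attractor step at `x`. A play uses a new edge at most once, as its first move.
  let S' : X → X → Prop := fun a b => S a b ∨ (a = x ∧ E a b ∧ (b ∈ dom S ∨ b ∈ T))
  have hsub : dom S ⊆ dom S' := fun a ⟨b, hb⟩ => ⟨b, Or.inl hb⟩
  have hold : ∀ a b, a ∈ dom S → S' a b → S a b := by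
    rintro a b ha (h | ⟨rfl, -⟩)
    · exact h
    · exact absurd ha hx
  have hnot : ∀ {a b}, S' a b → a ∉ T := by
    rintro a b (h | ⟨rfl, -⟩)
    · exact hS.notMem h
    · exact hxT
  have hcl : ∀ {a b}, S' a b → b ∈ dom S ∨ b ∈ T := by
    rintro a b (h | ⟨-, -, h⟩)
    · exact hS.closed h
    · exact h
  have hS' : Steers owner E p T Φ S' := by
    refine ⟨?_, hnot, fun h => (hcl h).imp_left fun h' => hsub h', ?_, ?_⟩
    · rintro a b (h | ⟨-, h, -⟩)
      · exact hS.edge h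
      · exact h
    · rintro a b c ha (h | ⟨rfl, -, -⟩) hc
      · exact Or.inl (hS.opp ha h hc)
      · exact Or.inr ⟨rfl, hc, hall ha c hc⟩
    · intro π hπ
      refine of_tail hΦ 1 π (hS.win _ fun k => hS.follow (m := 1) ?_ ?_ ?_ k)
      · exact fun k => hnot (hπ (k + 1))
      · exact (hcl (hπ 0)).resolve_right (hnot (hπ 1))
      · exact fun k hk => hold _ _ hk (hπ (k + 1))
  exact hx (hmax S' hS' ⟨fun a b h => Or.inl h, hold⟩ ⟨y, Or.inr ⟨rfl, hxy, hy⟩⟩)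

/-- Player one (two) wins if the maximum priority seen infinitely often is even (odd). -/
def ParityWin (prio : X → ℕ) (p : Player) (π : ℕ → X) : Prop :=
  ∃ c, IsGreatest {c | ∃ᶠ n in Filter.atTop, prio (π n) = c} c ∧ (Even c ↔ p = Player.one)

theorem parityWin_of_tail {prio : X → ℕ} {p : Player} (π : ℕ → X)
    (h : ParityWin prio p (fun n => π (n + 1))) : ParityWin prio p π := by
  have hset : ∀ c, (∃ᶠ n in Filter.atTop, prio (π (n + 1)) = c) ↔
      ∃ᶠ n in Filter.atTop, prio (π n) = c := by
    intro c
    conv_rhs => rw [← Filter.map_add_atTop_eq_nat 1]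
    exact (Filter.frequently_map (P := fun n => prio (π n) = c)).symm
  simpa only [ParityWin, hset] using h

theorem parityWin_of_frequently {prio : X → ℕ} {p : Player} {π : ℕ → X} {d : ℕ}
    (hp : Even d ↔ p = Player.one) (hle : ∀ n, prio (π n) ≤ d)
    (hd : ∃ᶠ n in Filter.atTop, prio (π n) = d) : ParityWin prio p π := by
  refine ⟨d, ⟨hd, fun c hc => ?_⟩, hp⟩
  obtain ⟨n, hn⟩ := Filter.Frequently.exists hc
  exact hn ▸ hle n

/-- Positional determinacy, with the favoured player's priority `d` on top, assuming determinacy for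
the priorities below `d`. -/
theorem exists_steers_of_lt (owner : X → Player) (prio : X → ℕ) {d : ℕ} {i j : Player}
    (htwo : ∀ q : Player, q = i ∨ q = j) (hi : Even d ↔ i = Player.one)
    (ih : ∀ E : X → X → Prop, (∀ x y, E x y → y ∈ dom E) → (∀ x ∈ dom E, prio x < d) →
      ∃ S : Player → X → X → Prop, (∀ p, Steers owner E p ∅ (ParityWin prio p) (S p)) ∧
        ∀ x ∈ dom E, ∃ p, x ∈ dom (S p))
    (E : X → X → Prop) (hE : ∀ x y, E x y → y ∈ dom E) (hd : ∀ x ∈ dom E, prio x ≤ d) :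
    ∃ Si Sj : X → X → Prop, Steers owner E i ∅ (ParityWin prio i) Si ∧
      Steers owner E j ∅ (ParityWin prio j) Sj ∧ ∀ x ∈ dom E, x ∈ dom Si ∨ x ∈ dom Sj := by
  obtain ⟨S, hS, hSmax⟩ := exists_maximal_steers owner E j ∅ (ParityWin prio j)
  have hSesc := fun {x y : X} => Steers.escape (x := x) (y := y) parityWin_of_tail hS hSmax
  -- By maximality of `S`, player `j` cannot leave `U`.
  let U : Set X := dom E \ dom S
  let EU : X → X → Prop := fun x y => E x y ∧ x ∈ U ∧ y ∈ U
  have hUj : ∀ {x y}, x ∈ U → owner x = j → E x y → EU x y := by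
    intro x y hx ho hxy
    refine ⟨hxy, hx, hE _ _ hxy, fun hy => ?_⟩
    exact (hSesc hx.2 (by simp) hxy (Or.inl hy)).1 ho
  have hUdom : ∀ {x}, x ∈ U → x ∈ dom EU := by
    intro x hx
    obtain ⟨y, hy⟩ := hx.1
    by_cases hyS : y ∈ dom S
    · obtain ⟨-, z, hz, hzS, -⟩ := hSesc hx.2 (by simp) hy (Or.inl hyS)
      exact ⟨z, hz, hx, hE _ _ hz, hzS⟩
    · exact ⟨y, hy, hx, hE _ _ hy, hyS⟩
  let N : Set X := {x | prio x = d}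
  -- With the condition `False` no infinite play follows `R`, so `R` forces a visit to `N`.
  obtain ⟨R, hR, hRmax⟩ := exists_maximal_steers owner EU i N (fun _ => False)
  have hResc := fun {x y : X} => Steers.escape (x := x) (y := y) (fun _ h => h) hR hRmax
  -- Player `i` cannot move from `Z` to the rest of `U`, and priorities on `Z` are below `d`.
  let Z : Set X := {x | x ∈ U ∧ x ∉ dom R ∧ x ∉ N}
  let EZ : X → X → Prop := fun x y => EU x y ∧ x ∈ Z ∧ y ∈ Z
  have hZi : ∀ {x y}, x ∈ Z → owner x = i → EU x y → EZ x y := by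
    intro x y hx ho hxy
    refine ⟨hxy, hx, hxy.2.2, not_or.1 fun hy => ?_⟩
    exact (hResc hx.2.1 hx.2.2 hxy hy).1 ho
  have hZdom : ∀ {x}, x ∈ Z → x ∈ dom EZ := by
    intro x hx
    obtain ⟨y, hy⟩ := hUdom hx.1
    by_cases hyR : y ∈ dom R ∨ y ∈ N
    · obtain ⟨-, z, hz, hzR⟩ := hResc hx.2.1 hx.2.2 hy hyR
      exact ⟨z, hz, hx, hz.2.2, hzR⟩
    · exact ⟨y, hy, hx, hy.2.2, not_or.1 hyR⟩
  obtain ⟨D, hD, hDdom⟩ := ih EZ (fun x y h => hZdom h.2.2) (by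
    rintro x ⟨y, hy⟩
    exact lt_of_le_of_ne (hd x hy.2.1.1.1) hy.2.1.2.2)
  have hDZ : ∀ {q x}, x ∈ dom (D q) → x ∈ Z := fun {q x} ⟨y, hy⟩ => ((hD q).edge hy).2.1
  have hDj : ∀ x, x ∉ dom (D j) := by
    -- If `j` won somewhere in `Z`, then `S` could be enlarged: the opponent can leave `Z` only into
    -- `dom S`, where `j` wins too.
    let S' : X → X → Prop := fun x y => S x y ∨ (x ∈ dom (D j) ∧ (D j x y ∨ owner x ≠ j ∧ E x y))
    have hold : ∀ a b, a ∈ dom S → S' a b → S a b := by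
      rintro a b ha (h | ⟨h, -⟩)
      · exact h
      · exact absurd ha (hDZ h).1.2
    have hcl : ∀ {x y}, x ∈ dom (D j) → (D j x y ∨ owner x ≠ j ∧ E x y) →
        D j x y ∨ y ∈ dom S := by
      rintro x y hx (h | ⟨ho, h⟩)
      · exact Or.inl h
      · by_cases hy : y ∈ dom S
        · exact Or.inr hy
        · obtain ⟨z, hz⟩ := hx
          exact Or.inl ((hD j).opp ho hz (hZi (hDZ ⟨z, hz⟩) ((htwo _).resolve_right ho)
            ⟨h, (hDZ ⟨z, hz⟩).1, hE _ _ h, hy⟩))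
    have hS' : Steers owner E j ∅ (ParityWin prio j) S' := by
      refine ⟨?_, by simp, ?_, ?_, ?_⟩
      · rintro x y (h | ⟨-, h | ⟨-, h⟩⟩)
        · exact hS.edge h
        · exact ((hD j).edge h).1.1
        · exact h
      · rintro x y (h | ⟨hx, h⟩)
        · obtain ⟨z, hz⟩ := (hS.closed h).resolve_right (by simp)
          exact Or.inl ⟨z, Or.inl hz⟩
        · rcases hcl hx h with h | ⟨z, hz⟩
          · obtain ⟨z, hz⟩ := ((hD j).closed h).resolve_right (by simp)
            exact Or.inl ⟨z, Or.inr ⟨⟨z, hz⟩, Or.inl hz⟩⟩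
          · exact Or.inl ⟨z, Or.inl hz⟩
      · rintro x y z ho (h | ⟨hx, -⟩) hz
        · exact Or.inl (hS.opp ho h hz)
        · exact Or.inr ⟨hx, Or.inr ⟨ho, hz⟩⟩
      · intro π hπ
        by_cases hent : ∃ m, π m ∈ dom S
        · obtain ⟨m, hm⟩ := hent
          refine of_tail parityWin_of_tail m π (hS.win _ fun k => hS.follow (by simp) hm ?_ k)
          intro k hk
          have := hπ (k + m)
          rw [Nat.add_right_comm] at this
          exact hold _ _ hk this
        · push Not at hent
          refine (hD j).win π fun k => ?_
          rcases hπ k with h | ⟨hx, h⟩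
          · exact absurd ⟨_, h⟩ (hent k)
          · exact (hcl hx h).resolve_right (hent _)
    intro x hx
    refine (hDZ hx).1.2 (hSmax S' hS' ⟨fun a b h => Or.inl h, hold⟩ ?_)
    obtain ⟨y, hy⟩ := hx
    exact ⟨y, Or.inr ⟨⟨y, hy⟩, Or.inl hy⟩⟩
  have hDi : ∀ {x}, x ∈ Z → x ∈ dom (D i) := by
    intro x hx
    obtain ⟨q, hq⟩ := hDdom x (hZdom hx)
    rcases htwo q with rfl | rfl
    · exact hq
    · exact absurd hq (hDj x)
  -- Player `i` wins on all of `U`: follow `D i` on `Z`, force `N` along `R`, and move freely within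
  -- `U` from `N`.
  let F : X → X → Prop := fun x y =>
    (x ∈ Z ∧ (D i x y ∨ owner x ≠ i ∧ EU x y)) ∨ R x y ∨ (x ∈ N ∧ EU x y)
  have hFE : ∀ {x y}, F x y → EU x y := by
    rintro x y (⟨-, h | ⟨-, h⟩⟩ | h | ⟨-, h⟩)
    · exact ((hD i).edge h).1
    · exact h
    · exact hR.edge h
    · exact h
  have hUF : ∀ {x}, x ∈ U → x ∈ dom F := by
    intro x hx
    by_cases hN : x ∈ N
    · obtain ⟨y, hy⟩ := hUdom hx
      exact ⟨y, Or.inr (Or.inr ⟨hN, hy⟩)⟩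
    by_cases hxR : x ∈ dom R
    · obtain ⟨y, hy⟩ := hxR
      exact ⟨y, Or.inr (Or.inl hy)⟩
    · obtain ⟨y, hy⟩ := hDi ⟨hx, hxR, hN⟩
      exact ⟨y, Or.inl ⟨⟨hx, hxR, hN⟩, Or.inl hy⟩⟩
  refine ⟨F, S, ⟨fun h => (hFE h).1, by simp, fun h => Or.inl (hUF (hFE h).2.2), ?_, ?_⟩, hS, ?_⟩
  · intro x y z ho h hz
    have hz' := hUj (hFE h).2.1 ((htwo _).resolve_left ho) hz
    rcases h with ⟨hx, -⟩ | h | ⟨hx, -⟩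
    · exact Or.inl ⟨hx, Or.inr ⟨ho, hz'⟩⟩
    · exact Or.inr (Or.inl (hR.opp ho h hz'))
    · exact Or.inr (Or.inr ⟨hx, hz'⟩)
  · intro π hπ
    by_cases hfr : ∃ᶠ n in Filter.atTop, prio (π n) = d
    · exact parityWin_of_frequently hi (fun n => hd _ (hFE (hπ n)).2.1.1) hfr
    · rw [Filter.not_frequently, Filter.eventually_atTop] at hfr
      obtain ⟨m, hm⟩ := hfr
      -- Once `N` is avoided, so is `dom R`, which would force `N`; the tail stays in `Z` and
      -- follows `D i`.
      have hnN : ∀ k, π (k + m) ∉ N := fun k => hm _ (Nat.le_add_left m k)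
      have hnR : ∀ k, π (k + m) ∉ dom R := by
        intro k hk
        refine hR.win (fun n => π (n + (k + m))) (hR.follow ?_ hk ?_)
        · intro n
          rw [← Nat.add_assoc]
          exact hnN _
        · intro n hn
          have := hπ (n + (k + m))
          rw [Nat.add_right_comm] at this
          rcases this with ⟨hz, -⟩ | h | ⟨hN, -⟩
          · exact absurd hn hz.2.1
          · exact h
          · rw [← Nat.add_assoc] at hN
            exact absurd hN (hnN _)
      have hZ : ∀ k, π (k + m) ∈ Z := fun k => ⟨(hFE (hπ (k + m))).2.1, hnR k, hnN k⟩
      refine of_tail parityWin_of_tail m π ((hD i).win _ fun k => ?_)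
      have hk := hπ (k + m)
      rw [Nat.add_right_comm] at hk
      rcases hk with ⟨hz, h | ⟨ho, h⟩⟩ | h | ⟨h, -⟩
      · exact h
      · obtain ⟨y, hy⟩ := hDi hz
        exact (hD i).opp ho hy ⟨h, hz, hZ (k + 1)⟩
      · exact absurd ⟨_, h⟩ (hnR k)
      · exact absurd h (hnN k)
  · intro x hx
    by_cases hxS : x ∈ dom S
    · exact Or.inr hxS
    · exact Or.inl (hUF ⟨hx, hxS⟩)

/-- Positional determinacy of parity games with boundedly many priorities on arbitrary graphs. -/
theorem exists_steers (owner : X → Player) (prio : X → ℕ) (d : ℕ) (E : X → X → Prop)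
    (hE : ∀ x y, E x y → y ∈ dom E) (hd : ∀ x ∈ dom E, prio x < d) :
    ∃ S : Player → X → X → Prop, (∀ p, Steers owner E p ∅ (ParityWin prio p) (S p)) ∧
      ∀ x ∈ dom E, ∃ p, x ∈ dom (S p) := by
  induction d generalizing E with
  | zero =>
    refine ⟨fun _ _ _ => False, fun p => ⟨False.elim, fun h => h.elim, False.elim, ?_, ?_⟩, ?_⟩
    · exact fun _ h => h.elim
    · exact fun π hπ => (hπ 0).elim
    · exact fun x hx => absurd (hd x hx) (Nat.not_lt_zero _)
  | succ d ih =>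
    have hd' : ∀ x ∈ dom E, prio x ≤ d := fun x hx => Nat.lt_succ_iff.1 (hd x hx)
    rcases Nat.even_or_odd d with hev | hodd
    · obtain ⟨S₁, S₂, h₁, h₂, h⟩ := exists_steers_of_lt owner prio (i := .one) (j := .two)
        (by rintro (_ | _) <;> simp) (by simpa using hev) ih E hE hd'
      refine ⟨fun | .one => S₁ | .two => S₂, ?_, fun x hx => ?_⟩
      · rintro (_ | _)
        · exact h₁
        · exact h₂
      · exact (h x hx).elim (fun h => ⟨.one, h⟩) (fun h => ⟨.two, h⟩)
    · obtain ⟨S₂, S₁, h₂, h₁, h⟩ := exists_steers_of_lt owner prio (i := .two) (j := .one)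
        (by rintro (_ | _) <;> simp) (by simpa using hodd) ih E hE hd'
      refine ⟨fun | .one => S₁ | .two => S₂, ?_, fun x hx => ?_⟩
      · rintro (_ | _)
        · exact h₁
        · exact h₂
      · exact (h x hx).elim (fun h => ⟨.two, h⟩) (fun h => ⟨.one, h⟩)

end ParityGames

/-! ### The product of the arena with the automaton -/

section Product

variable {V Q : Type*}

theorem DPW.run_congr {S : Type*} (M : DPW Q S) {w w' : ℕ → S} {n : ℕ}
    (h : ∀ k < n, w k = w' k) : M.run w n = M.run w' n := by
  induction n with
  | zero => rfl
  | succ n ih =>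
    simp only [DPW.run]
    rw [ih fun k hk => h k (hk.trans n.lt_succ_self), h n n.lt_succ_self]

/-- The moves in the product of the arena with the run of `M` on `π` and the play. -/
def productEdge (A : Arena V Player) (M : DPW Q (V × V)) (π : ℕ → V) (x y : ℕ × Q × V) : Prop :=
  y.1 = x.1 + 1 ∧ y.2.1 = M.step x.2.1 (π x.1, x.2.2) ∧ A.edge x.2.2 y.2.2

/-- The position of the product reached after the history `h u`. -/
def historyPosition (M : DPW Q (V × V)) (π : ℕ → V) (h : List V) (u : V) : ℕ × Q × V :=
  (h.length, M.run (fun n => (π n, h.getD n u)) h.length, u)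

/-- The position of the product reached by the play `ρ` after `n` moves. -/
def playPosition (M : DPW Q (V × V)) (π ρ : ℕ → V) (n : ℕ) : ℕ × Q × V :=
  (n, M.run (fun k => (π k, ρ k)) n, ρ n)

theorem historyPosition_ofFn (M : DPW Q (V × V)) (π ρ : ℕ → V) (n : ℕ) :
    historyPosition M π (List.ofFn fun j : Fin n => ρ j) (ρ n) = playPosition M π ρ n := by
  simp only [historyPosition, playPosition, List.length_ofFn]
  -- Only letters before `n` are read, so the default value of `getD` plays no role.
  rw [M.run_congr (w' := fun k => (π k, ρ k))]
  intro k hk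
  simp [List.getD, hk]

/-- A positional strategy on the product yields a strategy on the arena. -/
theorem exists_strategy_of_steers (A : Arena V Player) (M : DPW Q (V × V)) (π : ℕ → V)
    {p : Player} {Φ : (ℕ → ℕ × Q × V) → Prop} {S : ℕ × Q × V → ℕ × Q × V → Prop}
    (hS : Steers (fun x => A.owner x.2.2) (productEdge A M π) p ∅ Φ S) {v : V}
    (hv : (0, M.start, v) ∈ dom S) :
    ∃ σ : A.Strategy p, ∀ ρ ∈ σ.plays v, Φ (playPosition M π ρ) := by
  have hex : ∀ (h : List V) (u : V), ∃ w, A.edge u w ∧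
      (historyPosition M π h u ∈ dom S → ∃ y, S (historyPosition M π h u) y ∧ y.2.2 = w) := by
    intro h u
    by_cases hd : historyPosition M π h u ∈ dom S
    · obtain ⟨y, hy⟩ := hd
      exact ⟨y.2.2, (hS.edge hy).2.2, fun _ => ⟨y, hy, rfl⟩⟩
    · obtain ⟨w, hw⟩ := A.exists_succ u
      exact ⟨w, hw, fun h => absurd h hd⟩
  choose f hf hfS using hex
  refine ⟨⟨fun h u => f h u.1, fun h u => hf h u.1⟩, fun ρ hρ => hS.win _ ?_⟩
  obtain ⟨⟨h₀, hedge⟩, hcons⟩ := hρ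
  have step : ∀ k, playPosition M π ρ k ∈ dom S →
      S (playPosition M π ρ k) (playPosition M π ρ (k + 1)) := by
    intro k hk
    by_cases ho : A.owner (ρ k) = p
    · have hy := hfS (List.ofFn fun j : Fin k => ρ j) (ρ k)
      rw [historyPosition_ofFn] at hy
      obtain ⟨⟨n, q, w⟩, hy, hw⟩ := hy hk
      have hnext : ρ (k + 1) = w := (hcons k ho).trans hw.symm
      obtain ⟨hn, hq, -⟩ := hS.edge hy
      -- Clock and state are forced by `productEdge`, so choosing the vertex fixes the position.
      have heq : playPosition M π ρ (k + 1) = (n, q, w) :=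
        Prod.ext hn.symm (Prod.ext hq.symm hnext)
      rw [heq]
      exact hy
    · obtain ⟨y, hy⟩ := hk
      exact hS.opp ho hy ⟨rfl, rfl, hedge k⟩
  exact hS.follow (m := 0) (by simp) (by simpa [playPosition, DPW.run, h₀] using hv)
    (fun k hk => step k hk)

/-- Two strategies of the two players have a common play. -/
theorem Arena.exists_common_play (A : Arena V Player) (σ : A.Strategy Player.one)
    (τ : A.Strategy Player.two) (v : V) : ∃ ρ, ρ ∈ σ.plays v ∧ ρ ∈ τ.plays v := by
  have hex : ∀ (h : List V) (u : V), ∃ w, A.edge u w ∧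
      (∀ ho : A.owner u = Player.one, w = σ.next h ⟨u, ho⟩) ∧
      (∀ ho : A.owner u = Player.two, w = τ.next h ⟨u, ho⟩) := by
    intro h u
    have hor : A.owner u = Player.one ∨ A.owner u = Player.two := by
      cases A.owner u <;> simp
    rcases hor with ho | ho
    · exact ⟨_, σ.next_edge h ⟨u, ho⟩, fun _ => rfl, fun h' => by simp [ho] at h'⟩
    · exact ⟨_, τ.next_edge h ⟨u, ho⟩, fun h' => by simp [ho] at h', fun _ => rfl⟩
  choose f hf hσ hτ using hex
  let s : ℕ → List V × V := fun n => n.rec ([], v) fun _ x => (x.1 ++ [x.2], f x.1 x.2)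
  have hs : ∀ n, (s n).1 = List.ofFn fun j : Fin n => (s j).2 := by
    intro n
    induction n with
    | zero => rfl
    | succ n ih =>
      rw [List.ofFn_succ', List.concat_eq_append]
      simp only [Fin.val_castSucc, Fin.val_last, ← ih]
      rfl
  have hplay : (fun n => (s n).2) ∈ A.plays v := ⟨rfl, fun k => hf _ _⟩
  refine ⟨fun n => (s n).2, ⟨hplay, fun k hk => ?_⟩, ⟨hplay, fun k hk => ?_⟩⟩
  · rw [← hs k]
    exact hσ _ _ hk
  · rw [← hs k]
    exact hτ _ _ hk

/-- For every reference play, one of the players has a strategy that ensures the parity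
condition of the automaton in her favour. -/
theorem exists_winning_strategy [Finite Q] (A : Arena V Player) (M : DPW Q (V × V)) (π : ℕ → V)
    (v : V) : ∃ (p : Player) (σ : A.Strategy p), ∀ ρ ∈ σ.plays v,
      ParityWin (fun x : ℕ × Q × V => M.priority x.2.1) p (playPosition M π ρ) := by
  have hdom : ∀ x, x ∈ dom (productEdge A M π) := by
    intro x
    obtain ⟨w, hw⟩ := A.exists_succ x.2.2
    exact ⟨(x.1 + 1, M.step x.2.1 (π x.1, x.2.2), w), rfl, rfl, hw⟩
  obtain ⟨d, hd⟩ := (Set.finite_range M.priority).bddAbove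
  obtain ⟨S, hS, hcover⟩ := exists_steers (fun x : ℕ × Q × V => A.owner x.2.2)
    (fun x => M.priority x.2.1) (d + 1) (productEdge A M π) (fun _ y _ => hdom y)
    (fun x _ => Nat.lt_succ_of_le (hd ⟨x.2.1, rfl⟩))
  obtain ⟨p, hp⟩ := hcover _ (hdom (0, M.start, v))
  exact ⟨p, exists_strategy_of_steers A M π (hS p) hp⟩

end Product

end AutomaticGames

open AutomaticGames in
theorem mainTheorem7 {V : Type*} [Finite V] (G : AutomaticGames.ZeroSumGame V) (v : V) :
    G.val₁ v = G.arena.plays v \ G.val₂ v := by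
  obtain ⟨Q, _, M, hM⟩ := G.pref_automatic
  ext π
  constructor
  · rintro ⟨hπ, σ, hσ⟩
    refine ⟨hπ, ?_⟩
    rintro ⟨-, τ, hτ⟩
    obtain ⟨ρ, hρσ, hρτ⟩ := G.arena.exists_common_play σ τ v
    exact hτ ρ hρτ (hσ ρ hρσ)
  · rintro ⟨hπ, hnot⟩
    obtain ⟨p, σ, hσ⟩ := exists_winning_strategy G.arena M π v
    cases p with
    | one =>
      refine ⟨hπ, σ, fun ρ hρ => (hM π ρ).2 ?_⟩
      obtain ⟨c, hc, hpar⟩ := hσ ρ hρ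
      exact ⟨c, hc, hpar.2 rfl⟩
    | two =>
      refine absurd ⟨hπ, σ, fun ρ hρ hpref => ?_⟩ hnot
      obtain ⟨c, hc, hpar⟩ := hσ ρ hρ
      obtain ⟨c', hc', heven⟩ := (hM π ρ).1 hpref
      -- The maximum recurring priority is unique, so it cannot be even for `pref` and odd for
      -- player two.
      have heq : c' = c := hc'.unique hc
      subst heq
      exact Player.noConfusion (hpar.1 heven)
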